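/- A quantum graph $G$ consists of a finite-dimensional complex inner product space $V(G)$ and a real vector space $E(G)$ of self-adjoint operators on $V(G)$ that contains the identity. Its order is $\dim_{\mathbb C} V(G)$ and its valence is $\dim_{\mathbb R} E(G)-1$. A code of $G$ is a subspace $C\subseteq V(G)$ such that, for some function $\epsilon_C:E(G)\to\mathbb R$, $P_CAP_C=\epsilon_C(A)P_C$ for all $A\in E(G)$, where $P_C$ is the orthogonal projection onto $C$. Let $\alpha(G)$ be the largest dimension of a code of $G$, and let $\alpha(n,m)$ be the minimum of $\alpha(G)$ over all quantum graphs $G$ of order $n$ and valence $m$. Then for all integers $n\ge 1$ and $m\ge 0$ with $m+1\le n^2$ (that is, for all $n,m$ for which a quantum graph of order $n$ and valence $m$ exists), $$\left\lceil\frac{n}{m+1}\right\rceil\ \ge\ \alpha(n,m)\ \ge\ \left\lceil\frac{n}{(m+1)^2}\right\rceil .$$ -/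

import Mathlib

universe u

/-- A quantum graph with vertex space `V`, a finite-dimensional complex inner product space: a real
vector space of self-adjoint operators on `V` (the edge space) that contains the identity. -/
structure QuantumGraph (V : Type u) [NormedAddCommGroup V] [InnerProductSpace ℂ V]
    [FiniteDimensional ℂ V] where
  /-- The edge space. -/
  edges : Submodule ℝ (V →ₗ[ℂ] V)
  isSymmetric_of_mem : ∀ A ∈ edges, A.IsSymmetric
  id_mem : LinearMap.id ∈ edges

namespace QuantumGraph

variable {V : Type u} [NormedAddCommGroup V] [InnerProductSpace ℂ V] [FiniteDimensional ℂ V]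

/-- The order: the complex dimension of the vertex space. -/
noncomputable def order (_G : QuantumGraph V) : ℕ := Module.finrank ℂ V

/-- The valence: one less than the real dimension of the edge space (an integer, so that the
subtraction is not truncated). -/
noncomputable def valence (G : QuantumGraph V) : ℤ := (Module.finrank ℝ G.edges : ℤ) - 1

/-- A subspace `C` is a code if there is a function `ε` (its slope) with `P A P = ε(A) P` for every
edge operator `A`, where `P` is the orthogonal projection onto `C`. -/
def IsCode (G : QuantumGraph V) (C : Submodule ℂ V) : Prop :=
  ∃ ε : G.edges → ℝ, ∀ A : G.edges,
    (C.starProjection : V →ₗ[ℂ] V) ∘ₗ (A : V →ₗ[ℂ] V) ∘ₗ (C.starProjection : V →ₗ[ℂ] V) =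
      ε A • (C.starProjection : V →ₗ[ℂ] V)

/-- The independence number: the largest dimension of a code. The zero subspace is always a code,
and dimensions are at most that of `V`, so this is a maximum. -/
noncomputable def independenceNumber (G : QuantumGraph V) : ℕ :=
  sSup {d : ℕ | ∃ C : Submodule ℂ V, G.IsCode C ∧ Module.finrank ℂ C = d}

end QuantumGraph

/-- The least independence number among all quantum graphs of order `n` and valence `m`. -/
noncomputable def minIndependenceNumber (n m : ℕ) : ℕ :=
  sInf {a : ℕ | ∃ (V : Type u) (_ : NormedAddCommGroup V) (_ : InnerProductSpace ℂ V)
    (_ : FiniteDimensional ℂ V) (G : QuantumGraph V),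
    G.order = n ∧ G.valence = m ∧ G.independenceNumber = a}

/-!
For the lower bound, put `D = m + 1`. As long as fewer than `n / D` unit vectors have been chosen,
their images under the edge operators do not span `V`, and a unit vector orthogonal to all these
images can be added. If `q * D ^ 2 < n`, this yields `q * D + 1` unit vectors, no two of which are
linked by an edge operator. Their expectation functionals lie in the `D`-dimensional dual of the
edge space, so by a conic form of Tverberg's theorem the vectors can be split into `q + 1` classes
with weights `l i` such that the weighted sums of functionals over the classes all agree. The
vectors `∑ √(l i) • v i`, one for each class, then have the same expectation functional and span a
code of dimension `q + 1`.

For the upper bound, split an orthonormal basis of `V` into `m + 1` parts of size at most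
`⌈n / (m + 1)⌉`, and let the edge space contain the orthogonal projections onto the spans of the
parts. They sum to the identity, so on a nonzero code one of them has nonzero slope. That
projection is injective on the code, whose dimension is therefore at most its rank.
-/

open scoped InnerProductSpace
open Module (finrank)

section ColorfulCaratheodory

variable {H : Type*} [NormedAddCommGroup H] [InnerProductSpace ℝ H]

theorem real_inner_self_le_of_forall_norm_le {K : Set H} (hK : Convex ℝ K) {x y : H} (hx : x ∈ K)
    (hmin : ∀ w ∈ K, ‖x‖ ≤ ‖w‖) (hy : y ∈ K) : ⟪x, x⟫_ℝ ≤ ⟪x, y⟫_ℝ := by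
  have : Nonempty K := ⟨⟨x, hx⟩⟩
  have hinf : ‖0 - x‖ = ⨅ w : K, ‖0 - (w : H)‖ := by
    simp only [zero_sub, norm_neg]
    exact le_antisymm (le_ciInf fun w => hmin w w.2)
      (ciInf_le ⟨0, by rintro _ ⟨w, rfl⟩; exact norm_nonneg _⟩ (⟨x, hx⟩ : K))
  simpa [inner_sub_right] using (norm_eq_iInf_iff_real_inner_le_zero hK hx).1 hinf y hy

theorem card_le_finrank_of_affineIndependent_of_inner_eq [FiniteDimensional ℝ H] {τ : Type*}
    [Fintype τ] {z : τ → H} (hz : AffineIndependent ℝ z) {x : H} (hx : x ≠ 0) {c : ℝ}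
    (h : ∀ j, ⟪x, z j⟫_ℝ = c) : Fintype.card τ ≤ finrank ℝ H := by
  have hle : vectorSpan ℝ (Set.range z) ≤ (ℝ ∙ x)ᗮ := by
    rw [vectorSpan_def, Submodule.span_le]
    rintro _ ⟨_, ⟨i, rfl⟩, _, ⟨j, rfl⟩, rfl⟩
    simp [Submodule.mem_orthogonal_singleton_iff_inner_right, inner_sub_right, h]
  have hcard := hz.card_le_finrank_succ
  have hmono := Submodule.finrank_mono hle
  have hsum := (ℝ ∙ x).finrank_add_finrank_orthogonal
  rw [finrank_span_singleton hx] at hsum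
  omega

theorem exists_mem_convexHull_image_compl_singleton [FiniteDimensional ℝ H] {ι : Type*} [Fintype ι]
    (hcard : finrank ℝ H < Fintype.card ι) {p : ι → H} {x : H} (hx0 : x ≠ 0)
    (hx : x ∈ convexHull ℝ (Set.range p)) (hp : ∀ i, ⟪x, x⟫_ℝ ≤ ⟪x, p i⟫_ℝ) :
    ∃ i, x ∈ convexHull ℝ (p '' {i}ᶜ) := by
  obtain ⟨τ, _, z, w, hz, hind, hw, hw1, hsum⟩ := eq_pos_convex_span_of_mem_convexHull (𝕜 := ℝ) hx
  choose color hcolor using fun j => hz (Set.mem_range_self j)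
  have hle (j : τ) : w j * ⟪x, x⟫_ℝ ≤ w j * ⟪x, z j⟫_ℝ :=
    mul_le_mul_of_nonneg_left (hcolor j ▸ hp (color j)) (hw j).le
  have heq : ∑ j, w j * ⟪x, x⟫_ℝ = ∑ j, w j * ⟪x, z j⟫_ℝ := by
    rw [← Finset.sum_mul, hw1, one_mul]
    simp only [← real_inner_smul_right, ← inner_sum, hsum]
  have hplane (j : τ) : ⟪x, z j⟫_ℝ = ⟪x, x⟫_ℝ :=
    (mul_left_cancel₀ (hw j).ne'
      ((Finset.sum_eq_sum_iff_of_le fun j _ => hle j).1 heq j (Finset.mem_univ j))).symm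
  have hnot : ¬ Function.Surjective color := fun hsurj =>
    (Fintype.card_le_of_surjective color hsurj).not_gt
      ((card_le_finrank_of_affineIndependent_of_inner_eq hind hx0 hplane).trans_lt hcard)
  obtain ⟨i, hi⟩ := not_forall.1 hnot
  exact ⟨i, mem_convexHull_of_exists_fintype w z (fun j => (hw j).le) hw1
    (fun j => ⟨color j, fun h => hi ⟨j, h⟩, hcolor j⟩) hsum⟩

theorem exists_colorful_zero_mem_convexHull_of_finite [FiniteDimensional ℝ H] {ι : Type*}
    [Fintype ι] (hcard : finrank ℝ H < Fintype.card ι) {S : ι → Set H} (hfin : ∀ i, (S i).Finite)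
    (hS : ∀ i, 0 ∈ convexHull ℝ (S i)) :
    ∃ p : ι → H, (∀ i, p i ∈ S i) ∧ 0 ∈ convexHull ℝ (Set.range p) := by
  classical
  let U : Set H := ⋃ p ∈ Set.univ.pi S, convexHull ℝ (Set.range p)
  have hU : IsCompact U := (Set.Finite.pi hfin).isCompact_biUnion fun p _ =>
    (Set.finite_range p).isCompact_convexHull ℝ
  have hUne : U.Nonempty := by
    have : Nonempty ι := Fintype.card_pos_iff.1 (Nat.zero_lt_of_lt hcard)
    choose p hp using fun i => convexHull_nonempty_iff.1 ⟨0, hS i⟩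
    exact ⟨_, Set.mem_biUnion (fun i _ => hp i)
      (subset_convexHull ℝ _ (Set.mem_range_self (Classical.arbitrary ι)))⟩
  obtain ⟨x, hxU, hmin⟩ := hU.exists_isMinOn hUne continuous_norm.continuousOn
  obtain ⟨p, hp, hx⟩ := Set.mem_iUnion₂.1 hxU
  have hvar {p' : ι → H} (hp' : ∀ i, p' i ∈ S i) (hx' : x ∈ convexHull ℝ (Set.range p')) (i : ι) :
      ⟪x, x⟫_ℝ ≤ ⟪x, p' i⟫_ℝ :=
    real_inner_self_le_of_forall_norm_le (convex_convexHull ℝ _) hx'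
      (fun w hw => hmin (Set.mem_biUnion (fun i _ => hp' i) hw))
      (subset_convexHull ℝ _ (Set.mem_range_self i))
  suffices x = 0 from ⟨p, fun i => hp i trivial, this ▸ hx⟩
  by_contra hx0
  obtain ⟨i, hi⟩ := exists_mem_convexHull_image_compl_singleton hcard hx0 hx
    (hvar (fun i => hp i trivial) hx)
  have hswap : ∀ q ∈ S i, ⟪x, x⟫_ℝ ≤ ⟪x, q⟫_ℝ := fun q hq => by
    have hmem : ∀ j, Function.update p i q j ∈ S j := by
      intro j
      rcases eq_or_ne j i with rfl | hj
      · simpa using hq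
      · simpa [hj] using hp j trivial
    have hsub : p '' {i}ᶜ ⊆ Set.range (Function.update p i q) := by
      rintro _ ⟨j, hj, rfl⟩
      exact ⟨j, Function.update_of_ne hj _ _⟩
    simpa using hvar hmem (convexHull_mono hsub hi) i
  have hzero : ⟪x, x⟫_ℝ ≤ ⟪x, 0⟫_ℝ := convexHull_min hswap
    (convex_halfSpace_ge (f := fun y => ⟪x, y⟫_ℝ) (innerₛₗ ℝ x).isLinear _) (hS i)
  exact hx0 (real_inner_self_nonpos.1 (hzero.trans_eq (inner_zero_right x)))

theorem exists_colorful_zero_mem_convexHull {E ι : Type*} [AddCommGroup E] [Module ℝ E]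
    [FiniteDimensional ℝ E] [Fintype ι] (hcard : finrank ℝ E < Fintype.card ι) {S : ι → Set E}
    (hS : ∀ i, 0 ∈ convexHull ℝ (S i)) :
    ∃ p : ι → E, (∀ i, p i ∈ S i) ∧ 0 ∈ convexHull ℝ (Set.range p) := by
  have hfin (i : ι) : ∃ t : Finset E, ↑t ⊆ S i ∧ 0 ∈ convexHull ℝ (t : Set E) := by
    simpa only [convexHull_eq_union_convexHull_finite_subsets (S i), Set.mem_iUnion,
      exists_prop] using hS i
  choose T hTS hT using hfin
  let e : E ≃ₗ[ℝ] EuclideanSpace ℝ (Fin (finrank ℝ E)) := LinearEquiv.ofFinrankEq _ _ (by simp)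
  obtain ⟨p, hp, h⟩ := exists_colorful_zero_mem_convexHull_of_finite (S := fun i => e '' T i)
    (by simpa using hcard) (fun i => (T i).finite_toSet.image e) fun i => by
      have := Set.mem_image_of_mem e (hT i)
      rwa [map_zero, ← e.coe_coe, e.toLinearMap.image_convexHull] at this
  refine ⟨fun i => e.symm (p i), fun i => ?_, ?_⟩
  · obtain ⟨y, hy, hyp⟩ := hp i
    exact hTS i (by simpa [← hyp] using hy)
  · have := Set.mem_image_of_mem e.symm h
    rwa [map_zero, ← e.symm.coe_coe, e.symm.toLinearMap.image_convexHull, ← Set.range_comp] at this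

theorem mem_convexHull_range_iff_exists_stdSimplex {E ι : Type*} [AddCommGroup E] [Module ℝ E]
    [Fintype ι] {p : ι → E} {x : E} :
    x ∈ convexHull ℝ (Set.range p) ↔ ∃ l ∈ stdSimplex ℝ ι, ∑ i, l i • p i = x := by
  classical
  have hp : Set.range p = Fintype.linearCombination ℝ p '' Set.range fun i => Pi.single i 1 := by
    rw [← Set.range_comp]
    congr 1
    ext i
    simp
  rw [hp, ← LinearMap.image_convexHull, convexHull_rangle_single_eq_stdSimplex]
  rfl

theorem zero_mem_convexHull_range_of_sum_eq_zero {E κ : Type*} [AddCommGroup E] [Module ℝ E]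
    [Fintype κ] [Nonempty κ] {p : κ → E} (h : ∑ a, p a = 0) : 0 ∈ convexHull ℝ (Set.range p) :=
  mem_convexHull_of_exists_fintype (fun _ => (Fintype.card κ : ℝ)⁻¹) p (fun _ => by positivity)
    (by simp) Set.mem_range_self (by rw [← Finset.smul_sum, h, smul_zero])

-- Sarkaria's tensor trick: send `x i` with class `a` to `x i ⊗ u a`, where the `u a` sum to zero
-- and this is their only linear relation.
theorem exists_partition_sum_smul_eq {E ι κ : Type*} [AddCommGroup E] [Module ℝ E]
    [FiniteDimensional ℝ E] [Fintype ι] [Fintype κ] [DecidableEq κ]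
    (hcard : Fintype.card κ * finrank ℝ E < Fintype.card ι) (x : ι → E) :
    ∃ s : ι → Option κ, ∃ l ∈ stdSimplex ℝ ι, ∃ y : E, ∀ a, ∑ i with s i = a, l i • x i = y := by
  let p (i : ι) (a : Option κ) : κ → E := a.elim (fun _ => -x i) fun b => Pi.single b (x i)
  have hp (i : ι) : ∑ a, p i a = 0 := by
    ext b
    simp [p, Fintype.sum_option]
  obtain ⟨_, hs, h0⟩ := exists_colorful_zero_mem_convexHull (E := κ → E)
    (by simpa [Module.finrank_pi_fintype] using hcard)
    fun i => zero_mem_convexHull_range_of_sum_eq_zero (hp i)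
  choose s hs using hs
  obtain ⟨l, hl, hsum⟩ := mem_convexHull_range_iff_exists_stdSimplex.1 h0
  refine ⟨s, l, hl, ∑ i with s i = none, l i • x i, ?_⟩
  rintro (_ | b)
  · rfl
  have hb : ∑ i, l i • p i (s i) b = 0 := by
    simpa [hs] using congrFun hsum b
  rw [Finset.sum_filter, Finset.sum_filter, ← sub_eq_zero, ← Finset.sum_sub_distrib]
  refine Eq.trans (Finset.sum_congr rfl fun i _ => ?_) hb
  rcases s i with _ | b'
  · simp [p]
  · by_cases hb : b' = b <;> simp [p, hb, Ne.symm]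

end ColorfulCaratheodory

theorem exists_mem_orthogonal_norm_eq_one {𝕜 E : Type*} [RCLike 𝕜] [NormedAddCommGroup E]
    [InnerProductSpace 𝕜 E] [FiniteDimensional 𝕜 E] {W : Submodule 𝕜 E}
    (hW : finrank 𝕜 W < finrank 𝕜 E) : ∃ w ∈ Wᗮ, ‖w‖ = 1 := by
  have hne : Wᗮ ≠ ⊥ := fun h => by
    rw [Submodule.orthogonal_eq_bot_iff.1 h, finrank_top] at hW
    exact lt_irrefl _ hW
  obtain ⟨w, hw, hw0⟩ := Submodule.exists_mem_ne_zero_of_ne_bot hne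
  exact ⟨(‖w‖⁻¹ : 𝕜) • w, Submodule.smul_mem _ _ hw, norm_smul_inv_norm hw0⟩

namespace QuantumGraph

variable {V : Type u} [NormedAddCommGroup V] [InnerProductSpace ℂ V] [FiniteDimensional ℂ V]
  {G : QuantumGraph V}

theorem isCode_iff_exists_inner {C : Submodule ℂ V} :
    G.IsCode C ↔ ∃ ε : G.edges → ℝ, ∀ A : G.edges, ∀ x ∈ C, ∀ y ∈ C,
      ⟪x, (A : V →ₗ[ℂ] V) y⟫_ℂ = (ε A : ℂ) * ⟪x, y⟫_ℂ := by
  refine exists_congr fun ε => forall_congr' fun A => ⟨fun h x hx y hy => ?_, fun h => ?_⟩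
  · have hPx := Submodule.starProjection_eq_self_iff.2 hx
    have hPy := Submodule.starProjection_eq_self_iff.2 hy
    have hAy : C.starProjection ((A : V →ₗ[ℂ] V) y) = (ε A : ℂ) • y := by
      simpa [hPy] using LinearMap.congr_fun h y
    rw [← hPx, Submodule.inner_starProjection_left_eq_right, hAy, hPx, inner_smul_right]
  · refine LinearMap.ext fun z => ext_inner_left ℂ fun w => ?_
    have hPz := C.starProjection_apply_mem z
    have hwz := h _ (C.starProjection_apply_mem w) _ hPz
    rw [Submodule.inner_starProjection_left_eq_right, Submodule.inner_starProjection_left_eq_right,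
      Submodule.starProjection_eq_self_iff.2 hPz] at hwz
    simp only [LinearMap.comp_apply, LinearMap.smul_apply, ContinuousLinearMap.coe_coe]
    rw [RCLike.real_smul_eq_coe_smul (K := ℂ), inner_smul_right]
    exact hwz

theorem isCode_bot (G : QuantumGraph V) : G.IsCode ⊥ :=
  ⟨fun _ => 0, fun A => by ext x; simp⟩

theorem IsCode.finrank_le_independenceNumber {C : Submodule ℂ V} (hC : G.IsCode C) :
    finrank ℂ C ≤ G.independenceNumber :=
  le_csSup ⟨finrank ℂ V, by rintro _ ⟨C, -, rfl⟩; exact C.finrank_le⟩ ⟨C, hC, rfl⟩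

theorem independenceNumber_le {r : ℕ} (h : ∀ C, G.IsCode C → finrank ℂ C ≤ r) :
    G.independenceNumber ≤ r :=
  csSup_le ⟨_, ⊥, G.isCode_bot, rfl⟩ (by rintro _ ⟨C, hC, rfl⟩; exact h C hC)

/-- The diagonal `A ↦ ⟪v, A v⟫` of the edge space at a vector `v`. These values are real because
edge operators are self-adjoint, and for a unit vector they are the quantum expectations. -/
noncomputable def expectation (G : QuantumGraph V) (v : V) : Module.Dual ℝ G.edges where
  toFun A := (⟪v, (A : V →ₗ[ℂ] V) v⟫_ℂ).re
  map_add' A B := by simp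
  map_smul' r A := by simp

theorem ofReal_expectation (G : QuantumGraph V) (v : V) (A : G.edges) :
    (G.expectation v A : ℂ) = ⟪v, (A : V →ₗ[ℂ] V) v⟫_ℂ :=
  (G.isSymmetric_of_mem A A.2).coe_re_inner_self_apply v

theorem expectation_id (G : QuantumGraph V) (v : V) :
    G.expectation v ⟨LinearMap.id, G.id_mem⟩ = ‖v‖ ^ 2 :=
  inner_self_eq_norm_sq (𝕜 := ℂ) v

/-- A family of vectors is separated if no edge operator has a nonzero matrix entry between two
of its members. Separated families play the role of independent sets of vertices; as the identity
is an edge operator, they are orthogonal. -/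
def IsSeparated {ι : Type*} (G : QuantumGraph V) (v : ι → V) : Prop :=
  Pairwise fun i j => ∀ A ∈ G.edges, ⟪v i, A (v j)⟫_ℂ = 0

theorem IsSeparated.linearIndependent {ι : Type*} {v : ι → V} (hv : G.IsSeparated v)
    (h0 : ∀ i, v i ≠ 0) : LinearIndependent ℂ v :=
  linearIndependent_of_ne_zero_of_inner_eq_zero h0 fun _ _ hij => hv hij _ G.id_mem

theorem IsSeparated.isCode_span_range {κ : Type*} {w : κ → V} (hw : G.IsSeparated w)
    {y : Module.Dual ℝ G.edges} (hy : ∀ a, G.expectation (w a) = y) :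
    G.IsCode (Submodule.span ℂ (Set.range w)) := by
  let I : G.edges := ⟨LinearMap.id, G.id_mem⟩
  -- If `y I = 0`, then every `w a` is zero, so the junk value of the slope does no harm.
  have hdiv (a : κ) (A : G.edges) : y A = y A / y I * y I := by
    refine (div_mul_cancel_of_imp fun hI => ?_).symm
    have ha : w a = 0 := by
      rw [← hy a, expectation_id] at hI
      simpa using hI
    simp [← hy a, ha, expectation]
  have hbasis (A : G.edges) (a b : κ) :
      ⟪w a, (A : V →ₗ[ℂ] V) (w b)⟫_ℂ = (y A / y I : ℝ) * ⟪w a, w b⟫_ℂ := by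
    rcases eq_or_ne a b with rfl | hab
    · have hI : ((y I : ℝ) : ℂ) = ⟪w a, w a⟫_ℂ := hy a ▸ G.ofReal_expectation (w a) I
      rw [← ofReal_expectation, hy, ← hI, ← Complex.ofReal_mul, ← hdiv a]
    · have hI : ⟪w a, w b⟫_ℂ = 0 := hw hab _ G.id_mem
      rw [hw hab A A.2, hI, mul_zero]
  refine isCode_iff_exists_inner.2 ⟨fun A => y A / y I, fun A x hx z hz => ?_⟩
  induction hx, hz using Submodule.span_induction₂ with
  | mem_mem x z hx hz =>
    obtain ⟨⟨a, rfl⟩, ⟨b, rfl⟩⟩ := And.intro hx hz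
    exact hbasis A a b
  | zero_left => simp
  | zero_right => simp
  | add_left x y z _ _ _ hx hy => rw [inner_add_left, inner_add_left, hx, hy, mul_add]
  | add_right x y z _ _ _ hx hy => rw [map_add, inner_add_right, inner_add_right, hx, hy, mul_add]
  | smul_left k x z _ _ h => rw [inner_smul_left, inner_smul_left, h, mul_left_comm]
  | smul_right k x z _ _ h => rw [map_smul, inner_smul_right, inner_smul_right, h, mul_left_comm]

theorem IsSeparated.inner_sum_smul {ι : Type*} [DecidableEq ι] {v : ι → V} (hv : G.IsSeparated v)
    (c : ι → ℂ) (t t' : Finset ι) (A : G.edges) :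
    ⟪∑ i ∈ t, c i • v i, (A : V →ₗ[ℂ] V) (∑ i ∈ t', c i • v i)⟫_ℂ =
      ∑ i ∈ t ∩ t', ((‖c i‖ ^ 2 * G.expectation (v i) A : ℝ) : ℂ) := by
  rw [sum_inner, ← Finset.sum_ite_mem]
  refine Finset.sum_congr rfl fun i _ => ?_
  simp only [map_sum, map_smul, inner_sum, inner_smul_left, inner_smul_right]
  have hoff (j : ι) (hj : j ≠ i) :
      c j * (starRingEnd ℂ (c i) * ⟪v i, (A : V →ₗ[ℂ] V) (v j)⟫_ℂ) = 0 := by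
    rw [hv hj.symm A A.2, mul_zero, mul_zero]
  have hdiag : c i * (starRingEnd ℂ (c i) * ⟪v i, (A : V →ₗ[ℂ] V) (v i)⟫_ℂ) =
      ((‖c i‖ ^ 2 * G.expectation (v i) A : ℝ) : ℂ) := by
    rw [← mul_assoc, Complex.mul_conj', ← ofReal_expectation]
    push_cast
    rfl
  split_ifs with hi
  · rw [Finset.sum_eq_single_of_mem i hi fun j _ => hoff j, hdiag]
  · exact Finset.sum_eq_zero fun j hj => hoff j fun h => hi (h ▸ hj)

theorem IsSeparated.expectation_sum_smul {ι : Type*} {v : ι → V} (hv : G.IsSeparated v)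
    (c : ι → ℂ) (t : Finset ι) :
    G.expectation (∑ i ∈ t, c i • v i) = ∑ i ∈ t, ‖c i‖ ^ 2 • G.expectation (v i) := by
  classical
  ext A
  rw [← Complex.ofReal_inj, ofReal_expectation, hv.inner_sum_smul, Finset.inter_self]
  simp

theorem IsSeparated.sum_fiber_smul {ι κ : Type*} [Fintype ι] [DecidableEq κ] {v : ι → V}
    (hv : G.IsSeparated v) (c : ι → ℂ) (s : ι → κ) :
    G.IsSeparated fun a => ∑ i with s i = a, c i • v i := by
  classical
  intro a b hab A hA
  have hdisj : Disjoint ({i | s i = a} : Finset ι) ({i | s i = b} : Finset ι) :=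
    Finset.disjoint_filter.2 fun i _ ha hb => hab (ha.symm.trans hb)
  rw [hv.inner_sum_smul c _ _ ⟨A, hA⟩, Finset.disjoint_iff_inter_eq_empty.1 hdisj, Finset.sum_empty]

/-- The neighborhood of a family of vectors: the span of their images under the edge operators. A
vector orthogonal to it can be added to the family without creating edges. -/
def neighborhood {ι : Type*} (G : QuantumGraph V) (v : ι → V) : Submodule ℂ V :=
  Submodule.span ℂ (Set.range fun iA : ι × G.edges => (iA.2 : V →ₗ[ℂ] V) (v iA.1))

theorem finrank_neighborhood_le {ι : Type*} [Fintype ι] (G : QuantumGraph V) (v : ι → V) :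
    finrank ℂ (G.neighborhood v) ≤ Fintype.card ι * finrank ℝ G.edges := by
  let b := Module.finBasis ℝ G.edges
  let u (ik : ι × Fin (finrank ℝ G.edges)) : V := (b ik.2 : V →ₗ[ℂ] V) (v ik.1)
  have hle : G.neighborhood v ≤ Submodule.span ℂ (Set.range u) := by
    refine Submodule.span_le.2 ?_
    rintro _ ⟨⟨i, A⟩, rfl⟩
    have hA : (A : V →ₗ[ℂ] V) = ∑ k, b.repr A k • (b k : V →ₗ[ℂ] V) := by
      conv_lhs => rw [← b.sum_repr A]
      simp only [Submodule.coe_sum, Submodule.coe_smul]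
    simp only [hA, LinearMap.sum_apply, LinearMap.smul_apply]
    exact Submodule.sum_mem _ fun k _ =>
      Submodule.smul_of_tower_mem _ _ (Submodule.subset_span ⟨(i, k), rfl⟩)
  exact (Submodule.finrank_mono hle).trans ((finrank_range_le_card u).trans (by simp))

theorem IsSeparated.snoc {N : ℕ} {v : Fin N → V} (hv : G.IsSeparated v) {w : V}
    (hw : w ∈ (G.neighborhood v)ᗮ) :
    G.IsSeparated (Fin.snoc v w : Fin (N + 1) → V) := by
  have hnew (i : Fin N) (A : V →ₗ[ℂ] V) (hA : A ∈ G.edges) : ⟪w, A (v i)⟫_ℂ = 0 :=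
    have hmem : A (v i) ∈ G.neighborhood v := Submodule.subset_span ⟨(i, ⟨A, hA⟩), rfl⟩
    Submodule.inner_left_of_mem_orthogonal hmem hw
  intro i j hij A hA
  induction i using Fin.lastCases with
  | last =>
    induction j using Fin.lastCases with
    | last => exact absurd rfl hij
    | cast j => simpa using hnew j A hA
  | cast i =>
    induction j using Fin.lastCases with
    | last => simpa [← G.isSymmetric_of_mem A hA _ _] using inner_eq_zero_symm.1 (hnew i A hA)
    | cast j => simpa using hv (by simpa using hij) A hA

theorem exists_isSeparated_norm_eq_one (G : QuantumGraph V) (N : ℕ)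
    (hN : N * finrank ℝ G.edges < finrank ℂ V + finrank ℝ G.edges) :
    ∃ v : Fin N → V, G.IsSeparated v ∧ ∀ i, ‖v i‖ = 1 := by
  induction N with
  | zero => exact ⟨Fin.elim0, fun i => i.elim0, fun i => i.elim0⟩
  | succ N ih =>
    rw [add_mul, one_mul, Nat.add_lt_add_iff_right] at hN
    obtain ⟨v, hv, hv1⟩ := ih (hN.trans_le (Nat.le_add_right _ _))
    obtain ⟨w, hw, hw1⟩ := exists_mem_orthogonal_norm_eq_one
      ((G.finrank_neighborhood_le v).trans_lt (by simpa using hN))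
    refine ⟨Fin.snoc v w, hv.snoc hw, fun i => ?_⟩
    induction i using Fin.lastCases with
    | last => simpa using hw1
    | cast i => simpa using hv1 i

theorem lt_independenceNumber (G : QuantumGraph V) {q : ℕ}
    (hq : q * finrank ℝ G.edges ^ 2 < finrank ℂ V) : q < G.independenceNumber := by
  obtain ⟨v, hv, hv1⟩ := G.exists_isSeparated_norm_eq_one (q * finrank ℝ G.edges + 1) (by linarith)
  obtain ⟨s, l, hl, y, hy⟩ := exists_partition_sum_smul_eq (κ := Fin q)
    (by simp [Subspace.dual_finrank_eq]) fun i => G.expectation (v i)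
  let w (a : Option (Fin q)) : V := ∑ i with s i = a, (√(l i) : ℂ) • v i
  have hw : G.IsSeparated w := hv.sum_fiber_smul _ s
  have hwy (a) : G.expectation (w a) = y := by
    rw [hv.expectation_sum_smul, ← hy a]
    refine Finset.sum_congr rfl fun i _ => ?_
    rw [Complex.norm_real, Real.norm_of_nonneg (Real.sqrt_nonneg _), Real.sq_sqrt (hl.1 i)]
  have hmass (a) : ∑ i with s i = a, l i = ‖w a‖ ^ 2 := by
    rw [← expectation_id, hwy, ← hy a]
    simp [expectation_id, hv1]
  have hw0 (a) : w a ≠ 0 := by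
    intro ha
    have hfiber (a') : ∑ i with s i = a', l i = 0 := by
      have hnorm : ‖w a'‖ ^ 2 = ‖w a‖ ^ 2 := by
        rw [← expectation_id, ← expectation_id, hwy, hwy]
      rw [hmass, hnorm, ha, norm_zero, zero_pow two_ne_zero]
    have htotal := hl.2
    rw [← Finset.sum_fiberwise _ s, Finset.sum_eq_zero fun a' _ => hfiber a'] at htotal
    exact zero_ne_one htotal
  have hcode := (hw.isCode_span_range hwy).finrank_le_independenceNumber
  rw [finrank_span_eq_card (hw.linearIndependent hw0)] at hcode
  simpa using hcode

theorem finrank_le_independenceNumber_mul_sq (G : QuantumGraph V) :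
    finrank ℂ V ≤ G.independenceNumber * finrank ℝ G.edges ^ 2 :=
  not_lt.1 fun h => lt_irrefl _ (G.lt_independenceNumber h)

theorem IsCode.finrank_le_of_sum_eq_id {C : Submodule ℂ V} (hC : G.IsCode C) {κ : Type*}
    [Fintype κ] {A : κ → V →ₗ[ℂ] V} (hA : ∀ j, A j ∈ G.edges) (hsum : ∑ j, A j = LinearMap.id)
    {r : ℕ} (hr : ∀ j, finrank ℂ (A j).range ≤ r) : finrank ℂ C ≤ r := by
  obtain ⟨ε, hε⟩ := isCode_iff_exists_inner.1 hC
  by_cases h0 : ∀ j, ε ⟨A j, hA j⟩ = 0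
  · have hbot : C = ⊥ := (Submodule.eq_bot_iff C).2 fun x hx => by
      have hx0 : ⟪x, (∑ j, A j) x⟫_ℂ = 0 := by
        rw [LinearMap.sum_apply, inner_sum]
        refine Finset.sum_eq_zero fun j _ => ?_
        rw [hε ⟨A j, hA j⟩ x hx x hx, h0, Complex.ofReal_zero, zero_mul]
      simpa [hsum] using hx0
    exact (Submodule.finrank_eq_zero.2 hbot).trans_le r.zero_le
  · obtain ⟨j, hj⟩ := not_forall.1 h0
    have hinj : Function.Injective ((A j).rangeRestrict ∘ₗ C.subtype) := by
      refine (injective_iff_map_eq_zero _).2 fun x hx => ?_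
      have hAx : A j x = 0 := congrArg Subtype.val hx
      simpa [hAx, hj] using hε ⟨A j, hA j⟩ x x.2 x x.2
    exact (LinearMap.finrank_le_finrank_of_injective hinj).trans (hr j)

end QuantumGraph

theorem exists_le_le_finrank_eq {K M : Type*} [DivisionRing K] [AddCommGroup M] [Module K M]
    [FiniteDimensional K M] {S T : Submodule K M} (hST : S ≤ T) {d : ℕ}
    (hS : finrank K S ≤ d) (hT : d ≤ finrank K T) :
    ∃ E : Submodule K M, S ≤ E ∧ E ≤ T ∧ finrank K E = d := by
  induction d, hS using Nat.le_induction with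
  | base => exact ⟨S, le_rfl, hST, rfl⟩
  | succ d _ ih =>
    obtain ⟨E, hSE, hET, hE⟩ := ih (by omega)
    obtain ⟨x, hxT, hxE⟩ := SetLike.exists_of_lt
      (lt_of_le_of_ne hET fun h => by subst h; omega)
    have hle : finrank K ↥(K ∙ x ⊔ E) ≤ 1 + finrank K E :=
      (Submodule.finrank_add_le_finrank_add_finrank _ _).trans
        (Nat.add_le_add_right (by simpa using finrank_span_le_card (R := K) {x}) _)
    have hlt : finrank K E < finrank K ↥(K ∙ x ⊔ E) :=
      Submodule.finrank_lt_finrank_of_lt (Submodule.covBy_span_singleton_sup hxE).lt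
    exact ⟨K ∙ x ⊔ E, hSE.trans le_sup_right, sup_le (by simpa using hxT) hET, by omega⟩

theorem finrank_sq_le_finrank_selfAdjoint (V : Type*) [NormedAddCommGroup V]
    [InnerProductSpace ℂ V] [FiniteDimensional ℂ V] :
    finrank ℂ V ^ 2 ≤ finrank ℝ (selfAdjoint.submodule ℝ (V →ₗ[ℂ] V)) := by
  let S := selfAdjoint.submodule ℝ (V →ₗ[ℂ] V)
  let f : S × S →ₗ[ℝ] (V →ₗ[ℂ] V) := LinearMap.coprod S.subtype (Complex.I • S.subtype)
  have hf : Function.Surjective f := fun A =>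
    ⟨(realPart A, imaginaryPart A), realPart_add_I_smul_imaginaryPart A⟩
  have h := LinearMap.finrank_le_finrank_of_surjective hf
  rw [finrank_real_of_complex, Module.finrank_linearMap, Module.finrank_prod] at h
  change _ ≤ finrank ℝ S
  linarith

theorem exists_card_fiber_le {ι κ : Type*} [Fintype ι] [Fintype κ] [DecidableEq κ] {r : ℕ}
    (h : Fintype.card ι ≤ Fintype.card κ * r) :
    ∃ f : ι → κ, ∀ j, (Finset.univ.filter fun i => f i = j).card ≤ r := by
  obtain ⟨e⟩ : Nonempty (ι ↪ κ × Fin r) :=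
    Function.Embedding.nonempty_of_card_le (by simpa using h)
  refine ⟨fun i => (e i).1, fun j => ?_⟩
  have hinj : Set.InjOn (fun i => (e i).2) (Finset.univ.filter fun i => (e i).1 = j) := by
    intro a ha b hb hab
    simp only [Finset.coe_filter, Finset.mem_univ, true_and, Set.mem_ofPred_eq] at ha hb
    exact e.injective (Prod.ext (ha.trans hb.symm) hab)
  simpa using Finset.card_le_card_of_injOn _ (fun _ _ => Finset.mem_univ _) hinj

theorem exists_isSymmetric_sum_eq_id_finrank_range_le {𝕜 V κ : Type*} [RCLike 𝕜]
    [NormedAddCommGroup V] [InnerProductSpace 𝕜 V] [FiniteDimensional 𝕜 V] [Fintype κ] {r : ℕ}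
    (h : finrank 𝕜 V ≤ Fintype.card κ * r) :
    ∃ A : κ → V →ₗ[𝕜] V, (∀ j, (A j).IsSymmetric) ∧ ∑ j, A j = LinearMap.id ∧
      ∀ j, finrank 𝕜 (A j).range ≤ r := by
  classical
  obtain ⟨f, hf⟩ := exists_card_fiber_le (ι := Fin (finrank 𝕜 V)) (κ := κ) (by simpa using h)
  let b := stdOrthonormalBasis 𝕜 V
  let A (j : κ) : V →ₗ[𝕜] V :=
    ↑(∑ i with f i = j, InnerProductSpace.rankOne 𝕜 (b i) (b i) : V →L[𝕜] V)
  refine ⟨A, fun j x y => ?_, ?_, fun j => ?_⟩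
  · simp [A, sum_inner, inner_sum, inner_smul_left, inner_smul_right, mul_comm]
  · ext x
    simp only [A, LinearMap.sum_apply, ContinuousLinearMap.coe_coe, sum_apply,
      InnerProductSpace.rankOne_apply, LinearMap.id_apply]
    exact (Finset.sum_fiberwise _ _ _).trans (b.sum_repr' x)
  · have hle : (A j).range ≤ Submodule.span 𝕜 ↑(Finset.image b {i | f i = j}) := by
      rintro _ ⟨x, rfl⟩
      simp only [A, ContinuousLinearMap.coe_coe, sum_apply,
        InnerProductSpace.rankOne_apply]
      exact Submodule.sum_mem _ fun i hi =>
        Submodule.smul_mem _ _ (Submodule.subset_span (Finset.mem_image_of_mem b hi))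
    exact (Submodule.finrank_mono hle).trans
      ((finrank_span_finset_le_card _).trans (Finset.card_image_le.trans (hf j)))

namespace QuantumGraph

variable {V : Type u} [NormedAddCommGroup V] [InnerProductSpace ℂ V] [FiniteDimensional ℂ V]

theorem exists_valence_eq_of_sum_eq_id {κ : Type*} [Fintype κ] {m : ℕ} (hκ : Fintype.card κ ≤ m + 1)
    (hm : m + 1 ≤ finrank ℂ V ^ 2) {A : κ → V →ₗ[ℂ] V} (hA : ∀ j, (A j).IsSymmetric)
    (hsum : ∑ j, A j = LinearMap.id) :
    ∃ G : QuantumGraph V, G.valence = m ∧ ∀ j, A j ∈ G.edges := by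
  obtain ⟨E, hspan, hself, hE⟩ := exists_le_le_finrank_eq
    (S := Submodule.span ℝ (Set.range A)) (T := selfAdjoint.submodule ℝ (V →ₗ[ℂ] V))
    (Submodule.span_le.2 (by
      rintro _ ⟨j, rfl⟩
      exact (LinearMap.isSymmetric_iff_isSelfAdjoint _).1 (hA j)))
    ((finrank_range_le_card A).trans hκ) (hm.trans (finrank_sq_le_finrank_selfAdjoint V))
  have hAE (j : κ) : A j ∈ E := hspan (Submodule.subset_span ⟨j, rfl⟩)
  exact ⟨⟨E, fun B hB => (LinearMap.isSymmetric_iff_isSelfAdjoint _).2 (hself hB),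
    hsum ▸ Submodule.sum_mem _ fun j _ => hAE j⟩, by simp [valence, hE], hAE⟩

theorem exists_valence_eq_independenceNumber_le {m r : ℕ} (hm : m + 1 ≤ finrank ℂ V ^ 2)
    (hr : finrank ℂ V ≤ (m + 1) * r) :
    ∃ G : QuantumGraph V, G.valence = m ∧ G.independenceNumber ≤ r := by
  obtain ⟨A, hA, hsum, hrank⟩ :=
    exists_isSymmetric_sum_eq_id_finrank_range_le (𝕜 := ℂ) (V := V) (κ := Fin (m + 1))
      (by simpa using hr)
  obtain ⟨G, hG, hAG⟩ := exists_valence_eq_of_sum_eq_id (by simp) hm hA hsum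
  exact ⟨G, hG, independenceNumber_le fun C hC => hC.finrank_le_of_sum_eq_id hAG hsum hrank⟩

end QuantumGraph

theorem theorem1 (n m : ℕ) (h : m + 1 ≤ n ^ 2) :
    ⌈(n : ℚ) / ((m : ℚ) + 1)⌉₊ ≥ minIndependenceNumber.{u} n m ∧
      minIndependenceNumber.{u} n m ≥ ⌈(n : ℚ) / ((m : ℚ) + 1) ^ 2⌉₊ := by
  have hV : finrank ℂ (EuclideanSpace ℂ (ULift.{u} (Fin n))) = n := by simp
  have hceil : n ≤ (m + 1) * ⌈(n : ℚ) / ((m : ℚ) + 1)⌉₊ := by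
    have := (div_le_iff₀' (by positivity)).1 (Nat.le_ceil ((n : ℚ) / ((m : ℚ) + 1)))
    exact_mod_cast this
  obtain ⟨G, hm, hG⟩ := QuantumGraph.exists_valence_eq_independenceNumber_le
    (h.trans_eq (by rw [hV])) (hV.trans_le hceil)
  refine ⟨le_trans (Nat.sInf_le ⟨_, _, _, _, G, hV, hm, rfl⟩) hG,
    le_csInf ⟨_, _, _, _, _, G, hV, hm, rfl⟩ ?_⟩
  rintro _ ⟨V, _, _, _, G, hn, hm, rfl⟩
  have hedges : finrank ℝ G.edges = m + 1 := by
    simp only [QuantumGraph.valence] at hm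
    omega
  have hbound := G.finrank_le_independenceNumber_mul_sq
  rw [hedges, show finrank ℂ V = n from hn] at hbound
  rw [Nat.ceil_le, div_le_iff₀ (by positivity)]
  exact_mod_cast hbound
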